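/- Let $\mathcal{G}=\{(G_i,d_i)\}_{i\in I}$ be a family of groups with bi-invariant metrics of uniformly bounded diameter. A group $\Gamma$ is \emph{$\mathcal{G}$-approximable} if there is $c>0$ such that for every finite $F\subseteq\Gamma$ and every $\epsilon>0$ there are $i\in I$ and a function $\varphi:\Gamma\to G_i$ with $\varphi(e)=e$; with $d_i(\varphi(gh),\varphi(g)\varphi(h))<\epsilon$ whenever $g,h,gh\in F$ (that is, $\varphi$ is \emph{$(F,\epsilon)$-multiplicative}); and with $d_i(\varphi(g),e)>c$ for all $e\neq g\in F$. The group $\Gamma$ is - \emph{sofic} if $\mathcal{G}$ is the family of symmetric groups $\mathrm{Sym}(n)$, $n\geq 1$, with the normalized Hamming metrics, where for a finite set $A$ and $\sigma,\tau\in\mathrm{Sym}(A)$, $d_A(\sigma,\tau)=1-\frac{1}{|A|}|\{a\in A:\sigma(a)=\tau(a)\}|$; - \emph{$\mathbb{K}$-linear sofic} (for a field $\mathbb{K}$) if $\mathcal{G}$ is the family of the groups $\mathrm{GL}_n(\mathbb{K})$, $n\geq 1$, with $d(M,N)=\frac1n\mathrm{rk}(M-N)$; - \emph{hyperlinear} if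 $\mathcal{G}$ is the family of the unitary groups $U(n)$, $n\geq 1$, with $d(M,N)=\sqrt{\frac1n\sum_{i,j}|M_{i,j}-N_{i,j}|^2}$; - \emph{weakly sofic} if $\mathcal{G}$ is the family of all finite groups equipped with bi-invariant metrics of diameter one. An action $\alpha$ of a group $\Gamma$ on a set $X$ is \emph{sofic} if for all finite $F\subseteq\Gamma$, $E\subseteq X$ and every $\epsilon>0$ there exist a finite set $A$ and a function $\varphi:\Gamma\to\mathrm{Sym}(A)$ with $\varphi(e)=e$ which is $(F,\epsilon)$-multiplicative with respect to $d_A$, together with a finite set $B$, a subset $S\subseteq A$ with $|S|>(1-\epsilon)|A|$, and injections $\pi_s:E\hookrightarrow B$ $(s\in S)$, such that for all $g\in F$, $x\in E$, $s\in S$ with $\varphi(g)s\in S$ and $\alpha(g)^{-1}x\in E$ one has $\pi_{\varphi(g)s}(x)=\pi_s(\alpha(g)^{-1}x)$. For a set $X$ let $\mathrm{Sym}_f(X)$ be the group of permutations of $X$ with finite support, and let $\mathrm{Alt}_f(X)\leq\mathrm{Sym}_f(X)$ be the subgroup of even permutations (products of an even number of transpositions). An action $\alpha$ of $\Gamma$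 on $X$ induces actions of $\Gamma$ on $\mathrm{Sym}_f(X)$ and on $\mathrm{Alt}_f(X)$ by automorphisms, $g\cdot\sigma=\alpha(g)\sigma\alpha(g)^{-1}$; the associated semidirect products $\mathrm{Sym}_f(X)\rtimes\Gamma$ and $\mathrm{Alt}_f(X)\rtimes\Gamma$ are the \emph{symmetric enrichment} and the \emph{alternating enrichment} of $\alpha$. \textbf{Theorem.} Let $\Gamma$ be a sofic (respectively $\mathbb{K}$-linear sofic for a field $\mathbb{K}$; hyperlinear; weakly sofic) group, and let $\alpha$ be a sofic action of $\Gamma$ on a set $X$. Then $\mathrm{Sym}_f(X)\rtimes\Gamma$ and $\mathrm{Alt}_f(X)\rtimes\Gamma$ are sofic (respectively $\mathbb{K}$-linear sofic; hyperlinear; weakly sofic) groups. -/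

import Mathlib

universe u v w

/-- The normalized Hamming distance on the permutations of a finite set `A`. -/
noncomputable def hammingMetric {A : Type u} [Fintype A] [DecidableEq A]
    (σ τ : Equiv.Perm A) : ℝ :=
  1 - ((Finset.univ.filter fun a => σ a = τ a).card : ℝ) / (Fintype.card A : ℝ)

/-- The normalized rank distance on `GL n K`. -/
noncomputable def rankMetric {K : Type u} [Field K] {n : ℕ}
    (M N : Matrix.GeneralLinearGroup (Fin n) K) : ℝ :=
  (((M : Matrix (Fin n) (Fin n) K) - (N : Matrix (Fin n) (Fin n) K)).rank : ℝ) / (n : ℝ)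

/-- The normalized Hilbert-Schmidt distance on the unitary group `U(n)`. -/
noncomputable def hilbertSchmidtMetric {n : ℕ}
    (M N : Matrix.unitaryGroup (Fin n) ℂ) : ℝ :=
  Real.sqrt ((1 / (n : ℝ)) * ∑ i, ∑ j,
    ‖(M : Matrix (Fin n) (Fin n) ℂ) i j - (N : Matrix (Fin n) (Fin n) ℂ) i j‖ ^ 2)

/-- `φ` is `(F, ε)`-multiplicative with respect to the distance `d`. -/
def IsAlmostMultiplicative {Γ : Type u} {G : Type v} [Group Γ] [Group G] (d : G → G → ℝ)
    (F : Finset Γ) (ε : ℝ) (φ : Γ → G) : Prop :=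
  ∀ g ∈ F, ∀ h ∈ F, g * h ∈ F → d (φ (g * h)) (φ g * φ h) < ε

/-- `φ` is `(F, c)`-separating with respect to the distance `d`. -/
def IsSeparating {Γ : Type u} {G : Type v} [Group Γ] [Group G] (d : G → G → ℝ)
    (F : Finset Γ) (c : ℝ) (φ : Γ → G) : Prop :=
  ∀ g ∈ F, g ≠ 1 → c < d (φ g) 1

/-- `Γ` is approximable by the family of groups `G i` with distances `d i`: for some `c > 0`,
every finite `F ⊆ Γ` and every `ε > 0` there is a unital, `(F, ε)`-multiplicative and
`(F, c)`-separating function from `Γ` to a member of the family. -/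
def IsMetricApproximable {I : Type v} (G : I → Type w) [∀ i, Group (G i)]
    (d : ∀ i, G i → G i → ℝ) (Γ : Type u) [Group Γ] : Prop :=
  ∃ c : ℝ, 0 < c ∧ ∀ (F : Finset Γ) (ε : ℝ), 0 < ε →
    ∃ (i : I) (φ : Γ → G i), φ 1 = 1 ∧ IsAlmostMultiplicative (d i) F ε φ ∧
      IsSeparating (d i) F c φ

/-- Sofic groups: approximable by the symmetric groups with the normalized Hamming metrics. -/
def IsSoficGroup (Γ : Type u) [Group Γ] : Prop :=
  IsMetricApproximable (fun n : ℕ+ => Equiv.Perm (Fin n)) (fun _ => hammingMetric) Γ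

/-- `K`-linear sofic groups: approximable by the groups `GL n K` with the normalized rank
metrics. -/
def IsLinearSoficGroup (K : Type w) [Field K] (Γ : Type u) [Group Γ] : Prop :=
  IsMetricApproximable (fun n : ℕ+ => Matrix.GeneralLinearGroup (Fin n) K)
    (fun _ => rankMetric) Γ

/-- Hyperlinear groups: approximable by the unitary groups `U(n)` with the normalized
Hilbert-Schmidt metrics. -/
def IsHyperlinearGroup (Γ : Type u) [Group Γ] : Prop :=
  IsMetricApproximable (fun n : ℕ+ => Matrix.unitaryGroup (Fin n) ℂ)
    (fun _ => hilbertSchmidtMetric) Γ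

/-- A finite group together with a bi-invariant metric of diameter one. -/
structure FiniteMetricGroup where
  carrier : Type
  group : Group carrier
  finite : Finite carrier
  d : carrier → carrier → ℝ
  d_eq_zero_iff : ∀ x y, d x y = 0 ↔ x = y
  d_comm : ∀ x y, d x y = d y x
  d_triangle : ∀ x y z, d x z ≤ d x y + d y z
  d_mul_left : ∀ g x y, d (g * x) (g * y) = d x y
  d_mul_right : ∀ g x y, d (x * g) (y * g) = d x y
  d_le_one : ∀ x y, d x y ≤ 1
  exists_d_eq_one : ∃ x y, d x y = 1

instance finiteMetricGroup_group (G : FiniteMetricGroup) : Group G.carrier := G.group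

/-- Weakly sofic groups: approximable by the finite groups with bi-invariant metrics of diameter
one. -/
def IsWeaklySoficGroup (Γ : Type u) [Group Γ] : Prop :=
  IsMetricApproximable FiniteMetricGroup.carrier FiniteMetricGroup.d Γ

/-- `φ` is an `(F, E, ε)`-orbit approximation of the action of `Γ` on `X`. -/
def IsOrbitApproximation {Γ : Type u} {X : Type v} [Group Γ] [MulAction Γ X]
    {A : Type} [Fintype A] (F : Finset Γ) (E : Finset X) (ε : ℝ)
    (φ : Γ → Equiv.Perm A) : Prop :=
  ∃ (B : Type) (_ : Finite B) (S : Finset A) (π : S → (E ↪ B)),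
    (1 - ε) * (Fintype.card A : ℝ) < (S.card : ℝ) ∧
    ∀ g ∈ F, ∀ (x : X) (hx : x ∈ E) (s : A) (hs : s ∈ S)
      (hgs : φ g s ∈ S) (hgx : g⁻¹ • x ∈ E),
      π ⟨φ g s, hgs⟩ ⟨x, hx⟩ = π ⟨s, hs⟩ ⟨g⁻¹ • x, hgx⟩

/-- The action of `Γ` on the set `X` is sofic. -/
def IsSoficAction (Γ : Type u) (X : Type v) [Group Γ] [MulAction Γ X] : Prop :=
  ∀ (F : Finset Γ) (E : Finset X) (ε : ℝ), 0 < ε →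
    ∃ (A : Type) (_ : Fintype A) (_ : DecidableEq A) (φ : Γ → Equiv.Perm A),
      φ 1 = 1 ∧ IsAlmostMultiplicative hammingMetric F ε φ ∧ IsOrbitApproximation F E ε φ

/-- `Sym_f(X)`: the group of permutations of `X` with finite support. -/
def finSym (X : Type v) : Subgroup (Equiv.Perm X) where
  carrier := {σ | {x | σ x ≠ x}.Finite}
  one_mem' := by simp
  mul_mem' := by
    intro σ τ hσ hτ
    refine (Set.Finite.union hσ hτ).subset ?_
    intro x hx
    by_contra h
    simp only [Set.mem_union, Set.mem_ofPred_eq, not_or, not_not] at h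
    exact hx (by rw [Equiv.Perm.mul_apply, h.2, h.1])
  inv_mem' := by
    intro σ hσ
    refine Set.Finite.subset hσ ?_
    intro x hx h
    exact hx (by rw [Equiv.Perm.inv_eq_iff_eq, h])

open Classical in
/-- `Alt_f(X)`: the group of even permutations of `X`, that is, of the products of an even number
of transpositions. -/
def finAlt (X : Type v) : Subgroup (Equiv.Perm X) where
  carrier := {σ | ∃ l : List (Equiv.Perm X), (∀ τ ∈ l, τ.IsSwap) ∧ Even l.length ∧ l.prod = σ}
  one_mem' := ⟨[], by simp⟩
  mul_mem' := by
    rintro _ _ ⟨l, hl, hle, rfl⟩ ⟨m, hm, hme, rfl⟩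
    refine ⟨l ++ m, ?_, ?_, List.prod_append⟩
    · intro τ hτ
      rcases List.mem_append.1 hτ with h | h
      exacts [hl τ h, hm τ h]
    · rw [List.length_append]
      exact hle.add hme
  inv_mem' := by
    rintro _ ⟨l, hl, hle, rfl⟩
    refine ⟨(l.map fun τ => τ⁻¹).reverse, ?_, by simpa using hle, (List.prod_inv_reverse l).symm⟩
    intro τ hτ
    obtain ⟨ρ, hρ, rfl⟩ := List.mem_map.1 (List.mem_reverse.1 hτ)
    obtain ⟨x, y, hxy, rfl⟩ := hl ρ hρ
    exact ⟨x, y, hxy, Equiv.swap_inv x y⟩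

theorem finAlt_le_finSym (X : Type v) : finAlt X ≤ finSym X := by
  classical
  rintro _ ⟨l, hl, -, rfl⟩
  refine Subgroup.list_prod_mem _ fun τ hτ => ?_
  obtain ⟨x, y, -, rfl⟩ := hl τ hτ
  refine (Set.toFinite {x, y}).subset ?_
  intro z hz
  by_contra h
  simp only [Set.mem_insert_iff, Set.mem_singleton_iff, not_or] at h
  exact hz (Equiv.swap_apply_of_ne_of_ne h.1 h.2)

instance finSym_normal (X : Type v) : (finSym X).Normal where
  conj_mem := by
    intro σ hσ ρ
    refine (Set.Finite.image ρ hσ).subset ?_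
    intro x hx
    refine ⟨ρ⁻¹ x, fun h => hx ?_, by simp⟩
    rw [Equiv.Perm.mul_apply, Equiv.Perm.mul_apply, h]
    simp

instance finAlt_normal (X : Type v) : (finAlt X).Normal where
  conj_mem := by
    classical
    rintro _ ⟨l, hl, hle, rfl⟩ ρ
    refine ⟨l.map (MulAut.conj ρ), ?_, by simpa using hle, ?_⟩
    · intro τ hτ
      obtain ⟨κ, hκ, rfl⟩ := List.mem_map.1 hτ
      obtain ⟨x, y, hxy, rfl⟩ := hl κ hκ
      refine ⟨ρ x, ρ y, fun h => hxy (ρ.injective h), ?_⟩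
      rw [MulAut.conj_apply, Equiv.swap_apply_apply]
    · rw [← map_list_prod, MulAut.conj_apply]

/-- The action of `Γ` by automorphisms on a normal subgroup `N` of the permutation group of `X`,
where `g` sends `σ` to `α(g) σ α(g)⁻¹` and `α(g)` is the permutation `x ↦ g • x`. -/
def conjAction (Γ : Type u) {X : Type v} [Group Γ] [MulAction Γ X]
    (N : Subgroup (Equiv.Perm X)) [N.Normal] : Γ →* MulAut N :=
  MulAut.conjNormal.comp (MulAction.toPermHom Γ X)

/-- The symmetric enrichment `Sym_f(X) ⋊ Γ` of the action of `Γ` on `X`. -/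
abbrev SymEnrichment (Γ : Type u) (X : Type v) [Group Γ] [MulAction Γ X] : Type (max v u) :=
  SemidirectProduct (finSym X) Γ (conjAction Γ (finSym X))

/-- The alternating enrichment `Alt_f(X) ⋊ Γ` of the action of `Γ` on `X`. -/
abbrev AltEnrichment (Γ : Type u) (X : Type v) [Group Γ] [MulAction Γ X] : Type (max v u) :=
  SemidirectProduct (finAlt X) Γ (conjAction Γ (finAlt X))

/-!
Let `N` be `Sym_f(X)` or `Alt_f(X)`. The elements of `N ⋊ Γ` outside `N` are separated from the
identity by approximations pulled back from `Γ`, so what is missing is a sofic approximation that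
separates the elements of `N`. Soficity of the action provides `φ : Γ → Sym(A)` and labellings
`f_s : X → C`, injective on a large finite set `E`, with `f_{φ(g)s}(gx) = f_s(x)` for most `s`.
Transporting `σ ∈ N` supported in `E` along `f_s` gives `θ_s(σ) ∈ Sym(C)`, and the labelling
identity says that `θ` is a cocycle over `φ` for most `s`. Hence the skew product
`(s, c) ↦ (φ(g)s, θ_{φ(g)s}(σ) c)` on `A × Sym(C)` is almost multiplicative in `(σ, g)`. The fibre
is `Sym(C)` acting on itself by translation, rather than `C`, because nontrivial translations have
no fixed points: every `σ ≠ 1` in `N` thereby goes to distance almost one from the identity, whereas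
on `C` it would move only the points of its support.

The two approximations are combined in a product with the maximum distance. This stays within the
given family because each of the four families contains, up to uniform distortion, the symmetric
groups and the products of two of its members.
-/

section Approximation

variable {I J : Type*} {G : I → Type*} {H : J → Type*} [∀ i, Group (G i)] [∀ j, Group (H j)]
  {d : ∀ i, G i → G i → ℝ} {d' : ∀ j, H j → H j → ℝ} {Γ Δ : Type*} [Group Γ] [Group Δ]
  {K L : Set Γ}

/-- Approximability of `Γ` relative to a subset `K`: as in `IsMetricApproximable`, except that only
the elements of `K` have to be separated from the identity. It makes it possible to treat the kernel
and the quotient of a group extension by different families. -/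
def IsMetricApproximableOn (G : I → Type*) [∀ i, Group (G i)] (d : ∀ i, G i → G i → ℝ)
    (K : Set Γ) : Prop :=
  ∃ c : ℝ, 0 < c ∧ ∀ (F : Finset Γ) (ε : ℝ), 0 < ε →
    ∃ (i : I) (φ : Γ → G i), φ 1 = 1 ∧ IsAlmostMultiplicative (d i) F ε φ ∧
      ∀ g ∈ F, g ∈ K → g ≠ 1 → c < d i (φ g) 1

/-- The members of the family `(G, d)` embed homomorphically into members of the family `(H, d')`,
with moduli of continuity and of separation from the identity that are uniform over the family. -/
def UniformlyEmbeds (G : I → Type*) [∀ i, Group (G i)] (d : ∀ i, G i → G i → ℝ)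
    (H : J → Type*) [∀ j, Group (H j)] (d' : ∀ j, H j → H j → ℝ) : Prop :=
  ∃ (j : I → J) (ρ : ∀ i, G i →* H (j i)),
    (∀ ε > 0, ∃ δ > 0, ∀ i x y, d i x y < δ → d' (j i) (ρ i x) (ρ i y) < ε) ∧
    ∀ c > 0, ∃ c' > 0, ∀ i x, c < d i x 1 → c' < d' (j i) (ρ i x) 1

/-- The maximum distance on a product. -/
def maxDist {A B : Type*} (d : A → A → ℝ) (d' : B → B → ℝ) (p q : A × B) : ℝ :=
  max (d p.1 q.1) (d' p.2 q.2)

theorem UniformlyEmbeds.of_linear_bounds {a b : ℝ} (ha : 0 < a) (hb : 0 < b)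
    (h : ∀ i, ∃ (j : J) (ρ : G i →* H j),
      (∀ x y, d' j (ρ x) (ρ y) ≤ a * d i x y) ∧ ∀ x, d i x 1 ≤ b * d' j (ρ x) 1) :
    UniformlyEmbeds G d H d' := by
  choose j ρ hle hge using h
  refine ⟨j, ρ, fun ε hε => ⟨ε / a, by positivity, fun i x y hxy => ?_⟩,
    fun c hc => ⟨c / b, by positivity, fun i x hx => ?_⟩⟩
  · rw [lt_div_iff₀' ha] at hxy
    exact (hle i x y).trans_lt hxy
  · rw [div_lt_iff₀' hb]
    exact hx.trans_le (hge i x)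

theorem UniformlyEmbeds.refl (G : I → Type*) [∀ i, Group (G i)] (d : ∀ i, G i → G i → ℝ) :
    UniformlyEmbeds G d G d :=
  .of_linear_bounds one_pos one_pos fun i =>
    ⟨i, MonoidHom.id (G i), fun x y => (one_mul (d i x y)).ge, fun x => (one_mul (d i x 1)).ge⟩

theorem UniformlyEmbeds.maxDist_of_average (hd : ∀ i x y, 0 ≤ d i x y)
    (h : ∀ i i', ∃ (j : I) (ρ : G i × G i' →* G j),
      ∀ p q, d j (ρ p) (ρ q) = (d i p.1 q.1 + d i' p.2 q.2) / 2) :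
    UniformlyEmbeds (fun k : I × I => G k.1 × G k.2) (fun k => maxDist (d k.1) (d k.2)) G d := by
  refine .of_linear_bounds one_pos two_pos fun k => ?_
  obtain ⟨j, ρ, hρ⟩ := h k.1 k.2
  refine ⟨j, ρ, fun p q => ?_, fun p => max_le ?_ ?_⟩
  · rw [hρ, maxDist]
    linarith [le_max_left (d k.1 p.1 q.1) (d k.2 p.2 q.2),
      le_max_right (d k.1 p.1 q.1) (d k.2 p.2 q.2)]
  · rw [← map_one ρ, hρ]
    linarith [hd k.2 p.2 (1 : G k.1 × G k.2).2]
  · rw [← map_one ρ, hρ]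
    linarith [hd k.1 p.1 (1 : G k.1 × G k.2).1]

theorem isMetricApproximableOn_univ :
    IsMetricApproximableOn G d (Set.univ : Set Γ) ↔ IsMetricApproximable G d Γ := by
  simp only [IsMetricApproximableOn, IsMetricApproximable, IsSeparating, Set.mem_univ,
    forall_true_left]

theorem IsMetricApproximableOn.of_uniformlyEmbeds (hK : IsMetricApproximableOn G d K)
    (h : UniformlyEmbeds G d H d') : IsMetricApproximableOn H d' K := by
  obtain ⟨c, hc, hK⟩ := hK
  obtain ⟨j, ρ, hcont, hsep⟩ := h
  obtain ⟨c', hc', hsep⟩ := hsep c hc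
  refine ⟨c', hc', fun F ε hε => ?_⟩
  obtain ⟨δ, hδ, hcont⟩ := hcont ε hε
  obtain ⟨i, φ, hφ1, hφm, hφs⟩ := hK F δ hδ
  refine ⟨j i, fun g => ρ i (φ g), ?_, fun g hg h hh hgh => ?_, fun g hg hgK hg1 => ?_⟩
  · simp only [hφ1, map_one]
  · rw [← map_mul]
    exact hcont i _ _ (hφm g hg h hh hgh)
  · exact hsep i _ (hφs g hg hgK hg1)

theorem IsMetricApproximableOn.union (hK : IsMetricApproximableOn G d K)
    (hL : IsMetricApproximableOn H d' L) :
    IsMetricApproximableOn (fun k : I × J => G k.1 × H k.2)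
      (fun k => maxDist (d k.1) (d' k.2)) (K ∪ L) := by
  obtain ⟨a, ha, hK⟩ := hK
  obtain ⟨b, hb, hL⟩ := hL
  refine ⟨min a b, lt_min ha hb, fun F ε hε => ?_⟩
  obtain ⟨i, φ, hφ1, hφm, hφs⟩ := hK F ε hε
  obtain ⟨j, ψ, hψ1, hψm, hψs⟩ := hL F ε hε
  refine ⟨(i, j), fun g => (φ g, ψ g), Prod.ext hφ1 hψ1, fun g hg h hh hgh => ?_, ?_⟩
  · exact max_lt (hφm g hg h hh hgh) (hψm g hg h hh hgh)
  · rintro g hg (hgK | hgL) hg1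
    · exact (min_le_left a b).trans_lt ((hφs g hg hgK hg1).trans_le (le_max_left _ _))
    · exact (min_le_right a b).trans_lt ((hψs g hg hgL hg1).trans_le (le_max_right _ _))

theorem IsMetricApproximable.isMetricApproximableOn_compl_ker (hΓ : IsMetricApproximable G d Γ)
    (f : Δ →* Γ) : IsMetricApproximableOn G d ((f.ker : Set Δ)ᶜ) := by
  classical
  obtain ⟨c, hc, hΓ⟩ := hΓ
  refine ⟨c, hc, fun F ε hε => ?_⟩
  obtain ⟨i, φ, hφ1, hφm, hφs⟩ := hΓ (F.image f) ε hε
  have hF : ∀ g ∈ F, f g ∈ F.image f := fun g hg => Finset.mem_image_of_mem f hg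
  refine ⟨i, fun g => φ (f g), ?_, fun g hg h hh hgh => ?_, fun g hg hgf _ => ?_⟩
  · simp only [map_one, hφ1]
  · have hfgh := hF _ hgh
    simp only [map_mul] at hfgh ⊢
    exact hφm _ (hF g hg) _ (hF h hh) hfgh
  · exact hφs _ (hF g hg) hgf

end Approximation

section Hamming

theorem hammingDist_comp_equiv {A B C : Type*} [Fintype A] [Fintype B] [DecidableEq C]
    (x y : A → C) (e : B ≃ A) : hammingDist (x ∘ e) (y ∘ e) = hammingDist x y :=
  Finset.card_equiv e fun b => by
    simp only [Finset.mem_filter, Finset.mem_univ, true_and, Function.comp_apply]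

variable {A B : Type*} [Fintype A] [DecidableEq A] [Fintype B] [DecidableEq B]

theorem hammingMetric_eq_hammingDist_div [Nonempty A] (σ τ : Equiv.Perm A) :
    hammingMetric σ τ = (hammingDist σ τ : ℝ) / Fintype.card A := by
  have hA : (Fintype.card A : ℝ) ≠ 0 := Nat.cast_ne_zero.2 Fintype.card_ne_zero
  have hcard : ((Finset.univ.filter fun a => σ a = τ a).card : ℝ) + hammingDist σ τ
      = Fintype.card A := by
    exact_mod_cast Finset.card_filter_add_card_filter_not (s := Finset.univ) fun a => σ a = τ a
  rw [hammingMetric, eq_div_iff hA, sub_mul, div_mul_cancel₀ _ hA, ← hcard]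
  ring

theorem hammingMetric_nonneg [Nonempty A] (σ τ : Equiv.Perm A) : 0 ≤ hammingMetric σ τ := by
  rw [hammingMetric_eq_hammingDist_div]
  positivity

theorem hammingMetric_permCongr [Nonempty A] [Nonempty B] (e : A ≃ B) (σ τ : Equiv.Perm A) :
    hammingMetric (e.permCongr σ) (e.permCongr τ) = hammingMetric σ τ := by
  have hdist : hammingDist (e.permCongr σ) (e.permCongr τ) = hammingDist σ τ :=
    (hammingDist_comp (fun _ => e) fun _ => e.injective).trans
      (hammingDist_comp_equiv σ τ e.symm)
  rw [hammingMetric_eq_hammingDist_div, hammingMetric_eq_hammingDist_div, hdist,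
    Fintype.card_congr e]

theorem exists_permCongr_fin_isometry (A : Type*) [Fintype A] [DecidableEq A] [Nonempty A] :
    ∃ (n : ℕ+) (e : Equiv.Perm A ≃* Equiv.Perm (Fin n)),
      ∀ σ τ, hammingMetric (e σ) (e τ) = hammingMetric σ τ :=
  let n : ℕ+ := ⟨Fintype.card A, Fintype.card_pos⟩
  let e : A ≃ Fin n := Fintype.equivFin A
  ⟨n, e.permCongrHom, hammingMetric_permCongr e⟩

theorem hammingDist_prod_le {σ τ : Equiv.Perm (A × B)} {S : Finset A}
    (h : ∀ a ∉ S, ∀ b, σ (a, b) = τ (a, b)) : hammingDist σ τ ≤ S.card * Fintype.card B := by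
  rw [← Finset.card_univ (α := B), ← Finset.card_product]
  refine Finset.card_le_card fun ⟨a, b⟩ hab => ?_
  rw [Finset.mem_filter] at hab
  exact Finset.mem_product.2 ⟨by_contra fun ha => hab.2 (h a ha b), Finset.mem_univ b⟩

theorem le_hammingDist_prod {σ τ : Equiv.Perm (A × B)} {S : Finset A}
    (h : ∀ a ∈ S, ∀ b, σ (a, b) ≠ τ (a, b)) : S.card * Fintype.card B ≤ hammingDist σ τ := by
  rw [← Finset.card_univ (α := B), ← Finset.card_product]
  exact Finset.card_le_card fun ⟨a, b⟩ hab =>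
    Finset.mem_filter.2 ⟨Finset.mem_univ _, h a (Finset.mem_product.1 hab).1 b⟩

theorem hammingMetric_prod_le [Nonempty A] [Nonempty B] {σ τ : Equiv.Perm (A × B)} {S : Finset A}
    (h : ∀ a ∉ S, ∀ b, σ (a, b) = τ (a, b)) :
    hammingMetric σ τ ≤ (S.card : ℝ) / Fintype.card A := by
  have hB : (Fintype.card B : ℝ) ≠ 0 := Nat.cast_ne_zero.2 Fintype.card_ne_zero
  rw [hammingMetric_eq_hammingDist_div, Fintype.card_prod, ← mul_div_mul_right (S.card : ℝ) _ hB]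
  push_cast
  gcongr
  exact_mod_cast hammingDist_prod_le h

theorem le_hammingMetric_prod [Nonempty A] [Nonempty B] {σ τ : Equiv.Perm (A × B)} {S : Finset A}
    (h : ∀ a ∈ S, ∀ b, σ (a, b) ≠ τ (a, b)) :
    (S.card : ℝ) / Fintype.card A ≤ hammingMetric σ τ := by
  have hB : (Fintype.card B : ℝ) ≠ 0 := Nat.cast_ne_zero.2 Fintype.card_ne_zero
  rw [hammingMetric_eq_hammingDist_div, Fintype.card_prod, ← mul_div_mul_right (S.card : ℝ) _ hB]
  push_cast
  gcongr
  exact_mod_cast le_hammingDist_prod h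

theorem hammingDist_sumCongr (σ σ' : Equiv.Perm A) (τ τ' : Equiv.Perm B) :
    hammingDist (Equiv.Perm.sumCongr σ τ) (Equiv.Perm.sumCongr σ' τ')
      = hammingDist σ σ' + hammingDist τ τ' := by
  simp only [hammingDist, Finset.card_filter, Fintype.sum_sum_type]
  simp only [Equiv.Perm.sumCongr_apply, Sum.map_inl, Sum.map_inr, ne_eq, Sum.inl.injEq,
    Sum.inr.injEq]

/-- The diagonal action of permutations of `A` on the copies of `A` indexed by `B`. -/
def permAmplify (A B : Type*) : Equiv.Perm A →* Equiv.Perm (A × B) where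
  toFun σ := Equiv.prodCongr σ (Equiv.refl B)
  map_one' := Equiv.ext fun _ => rfl
  map_mul' _ _ := Equiv.ext fun _ => rfl

theorem hammingDist_permAmplify (σ τ : Equiv.Perm A) :
    hammingDist (permAmplify A B σ) (permAmplify A B τ) = hammingDist σ τ * Fintype.card B := by
  refine le_antisymm (hammingDist_prod_le (S := Finset.univ.filter fun a => σ a ≠ τ a) ?_)
    (le_hammingDist_prod (S := Finset.univ.filter fun a => σ a ≠ τ a) ?_)
  · intro a ha b
    rw [Finset.mem_filter_univ, not_not] at ha
    exact congrArg (·, b) ha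
  · intro a ha b hab
    exact (Finset.mem_filter_univ a).1 ha (congrArg Prod.fst hab)

theorem hammingMetric_permAmplify [Nonempty A] [Nonempty B] (σ τ : Equiv.Perm A) :
    hammingMetric (permAmplify A B σ) (permAmplify A B τ) = hammingMetric σ τ := by
  rw [hammingMetric_eq_hammingDist_div, hammingMetric_eq_hammingDist_div, hammingDist_permAmplify,
    Fintype.card_prod]
  push_cast
  field_simp

/-- The direct sum of permutations of `A` and of `B`, each repeated so that the two summands act on
sets of the same size. -/
def permAmplifiedSum (A B : Type*) :
    Equiv.Perm A × Equiv.Perm B →* Equiv.Perm (A × B ⊕ B × A) :=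
  (Equiv.Perm.sumCongrHom (A × B) (B × A)).comp ((permAmplify A B).prodMap (permAmplify B A))

theorem hammingMetric_permAmplifiedSum [Nonempty A] [Nonempty B]
    (p q : Equiv.Perm A × Equiv.Perm B) :
    hammingMetric (permAmplifiedSum A B p) (permAmplifiedSum A B q)
      = (hammingMetric p.1 q.1 + hammingMetric p.2 q.2) / 2 := by
  have hdist : hammingDist (permAmplifiedSum A B p) (permAmplifiedSum A B q)
      = hammingDist p.1 q.1 * Fintype.card B + hammingDist p.2 q.2 * Fintype.card A :=
    (hammingDist_sumCongr _ _ _ _).trans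
      (congrArg₂ (· + ·) (hammingDist_permAmplify _ _) (hammingDist_permAmplify _ _))
  simp only [hammingMetric_eq_hammingDist_div, hdist, Fintype.card_sum, Fintype.card_prod]
  push_cast
  field_simp
  ring

end Hamming

section Transport

variable {X C : Type*} {f f' : X → C} {σ τ : Equiv.Perm X}

open Classical in
/-- The permutation of `C` that corresponds to `τ` under a labelling `f` of the points of `X`; it is
the identity outside the labels of the support of `τ`. The labelling is required to be injective
on the support, and the junk value `1` is used otherwise. -/
noncomputable def transportPerm (f : X → C) (τ : Equiv.Perm X) : Equiv.Perm C :=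
  if h : Set.InjOn f {x | τ x ≠ x} then
    (τ.subtypePerm fun _ => Equiv.Perm.set_support_apply_mem).extendDomain
      (Equiv.Set.imageOfInjOn f {x | τ x ≠ x} h)
  else 1

theorem transportPerm_apply_of_ne (hf : Set.InjOn f {x | τ x ≠ x}) {x : X} (hx : τ x ≠ x) :
    transportPerm f τ (f x) = f (τ x) := by
  classical
  rw [transportPerm, dif_pos hf]
  exact Equiv.Perm.extendDomain_apply_image _ (Equiv.Set.imageOfInjOn f {x | τ x ≠ x} hf) ⟨x, hx⟩

theorem transportPerm_apply_of_notMem {c : C} (hc : c ∉ f '' {x | τ x ≠ x}) :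
    transportPerm f τ c = c := by
  classical
  rw [transportPerm]
  split_ifs
  · exact Equiv.Perm.extendDomain_apply_not_subtype _ _ hc
  · rfl

theorem transportPerm_apply {U : Set X} (hf : Set.InjOn f U) (hτ : {x | τ x ≠ x} ⊆ U) {x : X}
    (hx : x ∈ U) : transportPerm f τ (f x) = f (τ x) := by
  by_cases hτx : τ x = x
  · rw [hτx]
    refine transportPerm_apply_of_notMem ?_
    rintro ⟨y, hy, hyx⟩
    exact hy (hf (hτ hy) hx hyx ▸ hτx)
  · exact transportPerm_apply_of_ne (hf.mono hτ) hτx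

theorem transportPerm_one (f : X → C) : transportPerm f 1 = 1 :=
  Equiv.ext fun _ => transportPerm_apply_of_notMem fun ⟨_, hx, _⟩ => hx rfl

theorem transportPerm_ne_one (hf : Set.InjOn f {x | τ x ≠ x}) (hτ : τ ≠ 1) :
    transportPerm f τ ≠ 1 := by
  obtain ⟨x, hx⟩ : ∃ x, τ x ≠ x := not_forall.1 fun h => hτ (Equiv.ext h)
  intro h
  refine hx (hf (Equiv.Perm.set_support_apply_mem.2 hx) hx ?_)
  rw [← transportPerm_apply_of_ne hf hx, h, Equiv.Perm.one_apply]

theorem transportPerm_mul {U : Set X} (hf : Set.InjOn f U) (hσ : {x | σ x ≠ x} ⊆ U)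
    (hτ : {x | τ x ≠ x} ⊆ U) : transportPerm f (σ * τ) = transportPerm f σ * transportPerm f τ := by
  have hστ : {x | (σ * τ) x ≠ x} ⊆ U :=
    (Equiv.Perm.set_support_mul_subset σ τ).trans (Set.union_subset hσ hτ)
  ext c
  rw [Equiv.Perm.mul_apply]
  by_cases hc : c ∈ f '' U
  · obtain ⟨x, hx, rfl⟩ := hc
    have hτx : τ x ∈ U := by
      by_cases h : τ x = x
      · rwa [h]
      · exact hτ (Equiv.Perm.set_support_apply_mem.2 h)
    rw [transportPerm_apply hf hστ hx, transportPerm_apply hf hτ hx, transportPerm_apply hf hσ hτx,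
      Equiv.Perm.mul_apply]
  · have hfix : ∀ {ρ : Equiv.Perm X}, {x | ρ x ≠ x} ⊆ U → transportPerm f ρ c = c := fun hρ =>
      transportPerm_apply_of_notMem fun h => hc (Set.image_mono hρ h)
    rw [hfix hστ, hfix hτ, hfix hσ]

theorem support_conj (g τ : Equiv.Perm X) :
    {x | (g * τ * g⁻¹) x ≠ x} = g '' {x | τ x ≠ x} := by
  ext x
  rw [Equiv.image_eq_preimage_symm, Set.mem_preimage]
  exact not_congr (Equiv.eq_symm_apply g).symm

theorem transportPerm_conj {g : Equiv.Perm X} (hf : Set.InjOn f {x | τ x ≠ x})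
    (hff' : ∀ x, τ x ≠ x → f' (g x) = f x) :
    transportPerm f' (g * τ * g⁻¹) = transportPerm f τ := by
  have hf' : Set.InjOn f' {x | (g * τ * g⁻¹) x ≠ x} := by
    rw [support_conj]
    rintro _ ⟨x, hx, rfl⟩ _ ⟨y, hy, rfl⟩ hxy
    rw [hff' x hx, hff' y hy] at hxy
    rw [hf hx hy hxy]
  have himage : f' '' {x | (g * τ * g⁻¹) x ≠ x} = f '' {x | τ x ≠ x} := by
    rw [support_conj, Set.image_image]
    exact Set.image_congr hff'
  ext c
  by_cases hc : c ∈ f '' {x | τ x ≠ x}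
  · obtain ⟨x, hx, rfl⟩ := hc
    have hgx : (g * τ * g⁻¹) (g x) ≠ g x :=
      (support_conj g τ).ge (Set.mem_image_of_mem g hx)
    rw [transportPerm_apply_of_ne hf hx, ← hff' x hx, transportPerm_apply_of_ne hf' hgx,
      ← hff' (τ x) (Equiv.Perm.set_support_apply_mem.2 hx)]
    exact congrArg (fun y => f' (g (τ y))) (g.symm_apply_apply x)
  · rw [transportPerm_apply_of_notMem hc, transportPerm_apply_of_notMem (himage ▸ hc)]

end Transport

section OrbitApproximation

variable {Γ X : Type*} [Group Γ] [MulAction Γ X] {A : Type} [Fintype A] {F : Finset Γ}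
  {E : Finset X} {ε : ℝ} {φ : Γ → Equiv.Perm A}

theorem IsOrbitApproximation.nonempty (h : IsOrbitApproximation F E ε φ) : Nonempty A := by
  obtain ⟨B, _, S, π, hS, -⟩ := h
  by_contra hA
  rw [not_nonempty_iff] at hA
  simp only [Fintype.card_eq_zero, Finset.eq_empty_of_isEmpty S, Finset.card_empty,
    Nat.cast_zero, mul_zero, lt_self_iff_false] at hS

open Classical in
theorem IsOrbitApproximation.exists_labelling (h : IsOrbitApproximation F E ε φ) :
    ∃ (C : Type) (_ : Finite C) (S : Finset A) (f : A → X → C),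
      (1 - ε) * (Fintype.card A : ℝ) < S.card ∧
      (∀ s ∈ S, Set.InjOn (f s) E) ∧
      ∀ g ∈ F, ∀ x ∈ E, g • x ∈ E → ∀ s ∈ S, φ g s ∈ S → f (φ g s) (g • x) = f s x := by
  obtain ⟨B, _, S, π, hS, hπ⟩ := h
  let f (s : A) (x : X) : Option B := if h : s ∈ S ∧ x ∈ E then some (π ⟨s, h.1⟩ ⟨x, h.2⟩) else none
  have hf : ∀ {s x} (hs : s ∈ S) (hx : x ∈ E), f s x = some (π ⟨s, hs⟩ ⟨x, hx⟩) :=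
    fun hs hx => dif_pos ⟨hs, hx⟩
  refine ⟨Option B, inferInstance, S, f, hS, fun s hs x hx y hy hxy => ?_,
    fun g hg x hx hgx s hs hgs => ?_⟩
  · rw [hf hs hx, hf hs hy] at hxy
    exact congrArg Subtype.val ((π ⟨s, hs⟩).injective (Option.some_injective B hxy))
  · rw [hf hgs hgx, hf hs hx, hπ g hg (g • x) hgx s hs hgs (by rwa [inv_smul_smul])]
    simp only [inv_smul_smul]

theorem exists_finset_support_subset {N : Subgroup (Equiv.Perm X)} (hN : N ≤ finSym X) {M : Type*}
    (P : Finset M) (σ : M → N) (g : M → Γ) :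
    ∃ E : Finset X, (∀ p ∈ P, {x | (σ p : Equiv.Perm X) x ≠ x} ⊆ E) ∧
      ∀ p ∈ P, ∀ q ∈ P, (g p • ·) '' {x | (σ q : Equiv.Perm X) x ≠ x} ⊆ E := by
  have hfin : ∀ q, {x | (σ q : Equiv.Perm X) x ≠ x}.Finite := fun q => hN (σ q).2
  have hU : (⋃ q ∈ P, {x | (σ q : Equiv.Perm X) x ≠ x}).Finite :=
    P.finite_toSet.biUnion fun q _ => hfin q
  have hV : (⋃ p ∈ P, ⋃ q ∈ P, (g p • ·) '' {x | (σ q : Equiv.Perm X) x ≠ x}).Finite :=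
    P.finite_toSet.biUnion fun p _ => P.finite_toSet.biUnion fun q _ => (hfin q).image _
  refine ⟨(hU.union hV).toFinset, fun p hp => ?_, fun p hp q hq => ?_⟩ <;>
    rw [Set.Finite.coe_toFinset]
  · exact (Set.subset_biUnion_of_mem (u := fun q => {x | (σ q : Equiv.Perm X) x ≠ x}) hp).trans
      Set.subset_union_left
  · refine Set.Subset.trans ?_ Set.subset_union_right
    exact fun x hx => Set.mem_biUnion hp (Set.mem_biUnion hq hx)

end OrbitApproximation

section Cocycle

variable {Γ X C : Type*} [Group Γ] [MulAction Γ X] {N : Subgroup (Equiv.Perm X)} [N.Normal]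

theorem transportPerm_left_mul (p q : N ⋊[conjAction Γ N] Γ) {f f' : X → C} {U : Set X}
    (hf : Set.InjOn f U) (hf' : Set.InjOn f' U)
    (hp : {x | (p.left : Equiv.Perm X) x ≠ x} ⊆ U) (hq : {x | (q.left : Equiv.Perm X) x ≠ x} ⊆ U)
    (hpq : (p.right • ·) '' {x | (q.left : Equiv.Perm X) x ≠ x} ⊆ U)
    (hff' : ∀ x, (q.left : Equiv.Perm X) x ≠ x → f' (p.right • x) = f x) :
    transportPerm f' ((p * q).left : Equiv.Perm X)
      = transportPerm f' (p.left : Equiv.Perm X) * transportPerm f (q.left : Equiv.Perm X) := by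
  let g : Equiv.Perm X := MulAction.toPerm p.right
  have hleft : ((p * q).left : Equiv.Perm X) = p.left * (g * q.left * g⁻¹) := rfl
  have hconj : {x | (g * (q.left : Equiv.Perm X) * g⁻¹) x ≠ x} ⊆ U := by
    rw [support_conj]
    exact hpq
  rw [hleft, transportPerm_mul hf' hp hconj, transportPerm_conj (hf.mono hq) hff']

end Cocycle

section SkewProduct

theorem card_filter_apply_notMem {A : Type*} [Fintype A] [DecidableEq A] (ρ : Equiv.Perm A)
    (S : Finset A) :
    (Finset.univ.filter fun s => ρ s ∉ S).card + S.card = Fintype.card A := by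
  rw [← Finset.card_compl_add_card S]
  congr 1
  exact Finset.card_equiv ρ fun s => by
    rw [Finset.mem_filter_univ, Finset.mem_compl]

variable {N Γ A H : Type*} [Group N] [Group Γ] [Group H] {β : Γ →* MulAut N}
  {φ : Γ → Equiv.Perm A} {θ : A → N → H}

/-- The skew product over `φ` with fibre `H` on which `p` acts, above `s`, by left translation by
`θ (φ p.right s) p.left`. -/
def skewPerm (φ : Γ → Equiv.Perm A) (θ : A → N → H) (p : N ⋊[β] Γ) : Equiv.Perm (A × H) :=
  Equiv.prodShear (φ p.right) fun s => Equiv.mulLeft (θ (φ p.right s) p.left)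

theorem skewPerm_apply (p : N ⋊[β] Γ) (s : A) (c : H) :
    skewPerm φ θ p (s, c) = (φ p.right s, θ (φ p.right s) p.left * c) := rfl

theorem skewPerm_one (hφ : φ 1 = 1) (hθ : ∀ s, θ s 1 = 1) : skewPerm φ θ (1 : N ⋊[β] Γ) = 1 := by
  ext1 ⟨s, c⟩
  rw [skewPerm_apply, SemidirectProduct.one_right, SemidirectProduct.one_left, hφ, hθ, one_mul]
  rfl

variable [Fintype A] [DecidableEq A] [Fintype H] [DecidableEq H] {S : Finset A} {δ : ℝ}

theorem hammingMetric_skewPerm_mul_lt [Nonempty A] {p q : N ⋊[β] Γ}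
    (hS : (1 - δ) * Fintype.card A < S.card)
    (hφ : hammingMetric (φ (p.right * q.right)) (φ p.right * φ q.right) < δ)
    (hθ : ∀ s ∈ S, φ p.right s ∈ S →
      θ (φ p.right s) (p * q).left = θ (φ p.right s) p.left * θ s q.left) :
    hammingMetric (skewPerm φ θ (p * q)) (skewPerm φ θ p * skewPerm φ θ q) < 3 * δ := by
  let U₁ : Finset A :=
    Finset.univ.filter fun s => φ (p.right * q.right) s ≠ (φ p.right * φ q.right) s
  let U₂ : Finset A := Finset.univ.filter fun s => φ q.right s ∉ S
  let U₃ : Finset A := Finset.univ.filter fun s => (φ p.right * φ q.right) s ∉ S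
  have hA : (0 : ℝ) < Fintype.card A := Nat.cast_pos.2 Fintype.card_pos
  have hU₁ : (U₁.card : ℝ) < δ * Fintype.card A := by
    rwa [hammingMetric_eq_hammingDist_div, div_lt_iff₀ hA] at hφ
  have hnotMem : ∀ ρ : Equiv.Perm A,
      ((Finset.univ.filter fun s => ρ s ∉ S).card : ℝ) < δ * Fintype.card A := fun ρ => by
    have hcard : ((Finset.univ.filter fun s => ρ s ∉ S).card : ℝ) + S.card = Fintype.card A := by
      exact_mod_cast card_filter_apply_notMem ρ S
    linarith
  have hU : ((U₁ ∪ U₂ ∪ U₃).card : ℝ) ≤ U₁.card + U₂.card + U₃.card := by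
    exact_mod_cast (Finset.card_union_le _ U₃).trans
      (Nat.add_le_add_right (Finset.card_union_le U₁ U₂) _)
  calc hammingMetric (skewPerm φ θ (p * q)) (skewPerm φ θ p * skewPerm φ θ q)
      ≤ (U₁ ∪ U₂ ∪ U₃).card / Fintype.card A := hammingMetric_prod_le fun s hs c => ?_
    _ < 3 * δ := by
      rw [div_lt_iff₀ hA]
      linarith [hnotMem (φ q.right), hnotMem (φ p.right * φ q.right)]
  simp only [U₁, U₂, U₃, Finset.mem_union, Finset.mem_filter, Finset.mem_univ, true_and,
    not_or, not_not] at hs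
  obtain ⟨⟨hmul, hq⟩, hpq⟩ := hs
  rw [Equiv.Perm.mul_apply] at hmul hpq
  rw [Equiv.Perm.mul_apply, skewPerm_apply, skewPerm_apply, skewPerm_apply,
    SemidirectProduct.mul_right, hmul, hθ _ hq hpq, mul_assoc]

theorem lt_hammingMetric_skewPerm_one [Nonempty A] {p : N ⋊[β] Γ}
    (hS : (1 - δ) * Fintype.card A < S.card) (hφ : φ p.right = 1)
    (hθ : ∀ s ∈ S, θ s p.left ≠ 1) : 1 - δ < hammingMetric (skewPerm φ θ p) 1 := by
  rw [← lt_div_iff₀ (Nat.cast_pos.2 Fintype.card_pos)] at hS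
  refine hS.trans_le (le_hammingMetric_prod fun s hs c hfix => hθ s hs ?_)
  rw [skewPerm_apply, hφ] at hfix
  exact mul_eq_right.1 (congrArg Prod.snd hfix)

end SkewProduct

section SoficAction

variable {Γ X : Type*} [Group Γ] [MulAction Γ X] {N : Subgroup (Equiv.Perm X)} [N.Normal]

theorem IsSoficAction.isMetricApproximableOn_ker (hα : IsSoficAction Γ X) (hN : N ≤ finSym X) :
    IsMetricApproximableOn (fun n : ℕ+ => Equiv.Perm (Fin n)) (fun _ => hammingMetric)
      ((SemidirectProduct.rightHom : N ⋊[conjAction Γ N] Γ →* Γ).ker :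
        Set (N ⋊[conjAction Γ N] Γ)) := by
  classical
  refine ⟨1 / 2, one_half_pos, fun P ε hε => ?_⟩
  obtain ⟨E, hE, hPE⟩ := exists_finset_support_subset hN P
    SemidirectProduct.left SemidirectProduct.right
  let F : Finset Γ := P.image SemidirectProduct.right
  have hF : ∀ p ∈ P, p.right ∈ F := fun p hp => Finset.mem_image_of_mem _ hp
  let δ : ℝ := min (ε / 3) (1 / 2)
  have hδε : 3 * δ ≤ ε := by linarith [min_le_left (ε / 3) (1 / 2)]
  have hδ : δ ≤ 1 / 2 := min_le_right _ _
  obtain ⟨A, _, _, φ, hφ1, hφ, hlabel⟩ := hα F E δ (by positivity)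
  obtain ⟨C, _, S, f, hS, hfE, hf⟩ := hlabel.exists_labelling
  have : Fintype C := Fintype.ofFinite C
  have : Nonempty A := hlabel.nonempty
  let θ (s : A) (σ : N) : Equiv.Perm C := transportPerm (f s) σ
  obtain ⟨n, e, he⟩ := exists_permCongr_fin_isometry (A × Equiv.Perm C)
  refine ⟨n, fun p => e (skewPerm φ θ p), ?_, fun p hp q hq hpq => ?_, fun p hp hker hp1 => ?_⟩
  · beta_reduce
    rw [skewPerm_one (θ := θ) hφ1 fun s => transportPerm_one (f s), map_one]
  · beta_reduce
    rw [← map_mul, he]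
    refine (hammingMetric_skewPerm_mul_lt hS
      (hφ _ (hF p hp) _ (hF q hq) (hF _ hpq)) ?_).trans_le hδε
    intro s hs hps
    refine transportPerm_left_mul p q (hfE s hs) (hfE _ hps) (hE p hp) (hE q hq) (hPE p hp q hq)
      fun x hx => ?_
    exact hf _ (hF p hp) x (hE q hq hx) (hPE p hp q hq ⟨x, hx, rfl⟩) s hs hps
  · have hright : p.right = 1 := hker
    have hleft : (p.left : Equiv.Perm X) ≠ 1 := fun h =>
      hp1 (SemidirectProduct.ext (Subtype.ext h) hright)
    beta_reduce
    rw [← map_one e, he]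
    refine lt_of_le_of_lt (by linarith) (lt_hammingMetric_skewPerm_one hS (hright ▸ hφ1) ?_)
    exact fun s hs => transportPerm_ne_one ((hfE s hs).mono (hE p hp)) hleft

theorem IsMetricApproximable.semidirectProduct {I : Type*} {G : I → Type*} [∀ i, Group (G i)]
    {d : ∀ i, G i → G i → ℝ} (hΓ : IsMetricApproximable G d Γ)
    (hperm : UniformlyEmbeds (fun n : ℕ+ => Equiv.Perm (Fin n)) (fun _ => hammingMetric) G d)
    (hprod : UniformlyEmbeds (fun k : I × I => G k.1 × G k.2)
      (fun k => maxDist (d k.1) (d k.2)) G d)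
    (hα : IsSoficAction Γ X) (hN : N ≤ finSym X) :
    IsMetricApproximable G d (N ⋊[conjAction Γ N] Γ) := by
  have hker := (hα.isMetricApproximableOn_ker hN).of_uniformlyEmbeds hperm
  have hcompl := hΓ.isMetricApproximableOn_compl_ker
    (SemidirectProduct.rightHom : N ⋊[conjAction Γ N] Γ →* Γ)
  rw [← isMetricApproximableOn_univ, ← Set.union_compl_self]
  exact (hker.union hcompl).of_uniformlyEmbeds hprod

end SoficAction

section Sofic

theorem uniformlyEmbeds_perm_prod_perm :
    UniformlyEmbeds (fun k : ℕ+ × ℕ+ => Equiv.Perm (Fin k.1) × Equiv.Perm (Fin k.2))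
      (fun _ => maxDist hammingMetric hammingMetric)
      (fun n : ℕ+ => Equiv.Perm (Fin n)) (fun _ => hammingMetric) := by
  refine .maxDist_of_average (fun n : ℕ+ => hammingMetric_nonneg (A := Fin n)) fun m n => ?_
  obtain ⟨k, e, he⟩ := exists_permCongr_fin_isometry (Fin m × Fin n ⊕ Fin n × Fin m)
  exact ⟨k, e.toMonoidHom.comp (permAmplifiedSum (Fin m) (Fin n)), fun p q =>
    (he _ _).trans (hammingMetric_permAmplifiedSum p q)⟩

end Sofic

section WeaklySofic

/-- The permutations of `A` with the Hamming metric. A derangement has distance one from the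
identity, so its existence makes the diameter one. -/
noncomputable def permFiniteMetricGroup (A : Type) [Fintype A] [DecidableEq A] [Nonempty A]
    (h : (derangements A).Nonempty) : FiniteMetricGroup where
  carrier := Equiv.Perm A
  group := inferInstance
  finite := inferInstance
  d := hammingMetric
  d_eq_zero_iff σ τ := by
    rw [hammingMetric_eq_hammingDist_div, div_eq_zero_iff,
      or_iff_left (Nat.cast_ne_zero.2 Fintype.card_ne_zero), Nat.cast_eq_zero,
      hammingDist_eq_zero, DFunLike.coe_fn_eq]
  d_comm σ τ := by
    rw [hammingMetric_eq_hammingDist_div, hammingMetric_eq_hammingDist_div, hammingDist_comm]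
  d_triangle ρ σ τ := by
    simp only [hammingMetric_eq_hammingDist_div, ← add_div]
    gcongr
    exact_mod_cast hammingDist_triangle ρ σ τ
  d_mul_left ρ σ τ := by
    rw [hammingMetric_eq_hammingDist_div, hammingMetric_eq_hammingDist_div]
    exact congrArg (fun k : ℕ => (k : ℝ) / Fintype.card A)
      (hammingDist_comp (fun _ => ρ) fun _ => ρ.injective)
  d_mul_right ρ σ τ := by
    simp only [hammingMetric_eq_hammingDist_div, Equiv.Perm.coe_mul, hammingDist_comp_equiv]
  d_le_one σ τ := by
    rw [hammingMetric_eq_hammingDist_div]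
    exact div_le_one_of_le₀ (Nat.cast_le.2 hammingDist_le_card_fintype) (Nat.cast_nonneg _)
  exists_d_eq_one := by
    obtain ⟨σ, hσ⟩ := h
    refine ⟨σ, 1, ?_⟩
    have hcard : (Finset.univ.filter fun a => σ a = (1 : Equiv.Perm A) a).card = 0 :=
      Finset.card_eq_zero.2 (Finset.filter_false_of_mem fun a _ => hσ a)
    rw [hammingMetric, hcard, Nat.cast_zero, zero_div, sub_zero]

theorem FiniteMetricGroup.d_nonneg (G : FiniteMetricGroup) (x y : G.carrier) : 0 ≤ G.d x y := by
  have h := G.d_triangle x y x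
  rw [G.d_comm y x, (G.d_eq_zero_iff x x).2 rfl] at h
  linarith

/-- The product of two finite metric groups with the maximum metric. -/
def FiniteMetricGroup.prod (G H : FiniteMetricGroup) : FiniteMetricGroup where
  carrier := G.carrier × H.carrier
  group := inferInstance
  finite :=
    have := G.finite
    have := H.finite
    inferInstance
  d := maxDist G.d H.d
  d_eq_zero_iff x y := by
    rw [Prod.ext_iff, ← G.d_eq_zero_iff, ← H.d_eq_zero_iff]
    refine ⟨fun h => ⟨?_, ?_⟩, fun h => by rw [maxDist, h.1, h.2, max_self]⟩
    · exact le_antisymm ((le_max_left _ _).trans h.le) (G.d_nonneg _ _)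
    · exact le_antisymm ((le_max_right _ _).trans h.le) (H.d_nonneg _ _)
  d_comm x y := congrArg₂ max (G.d_comm _ _) (H.d_comm _ _)
  d_triangle x y z := max_le
    ((G.d_triangle _ y.1 _).trans (add_le_add (le_max_left _ _) (le_max_left _ _)))
    ((H.d_triangle _ y.2 _).trans (add_le_add (le_max_right _ _) (le_max_right _ _)))
  d_mul_left _ _ _ := congrArg₂ max (G.d_mul_left _ _ _) (H.d_mul_left _ _ _)
  d_mul_right _ _ _ := congrArg₂ max (G.d_mul_right _ _ _) (H.d_mul_right _ _ _)
  d_le_one _ _ := max_le (G.d_le_one _ _) (H.d_le_one _ _)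
  exists_d_eq_one := by
    obtain ⟨x, y, h⟩ := G.exists_d_eq_one
    exact ⟨(x, 1), (y, 1), le_antisymm (max_le (G.d_le_one _ _) (H.d_le_one _ _))
      (h.ge.trans (le_max_left _ _))⟩

theorem uniformlyEmbeds_perm_finiteMetricGroup :
    UniformlyEmbeds (fun n : ℕ+ => Equiv.Perm (Fin n)) (fun _ => hammingMetric)
      FiniteMetricGroup.carrier FiniteMetricGroup.d := by
  refine .of_linear_bounds one_pos one_pos fun n => ?_
  have hder : (derangements (Fin n × Bool)).Nonempty :=
    ⟨Equiv.prodCongr (Equiv.refl _) Equiv.boolNot,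
      fun a h => Bool.not_ne_self a.2 (congrArg Prod.snd h)⟩
  refine ⟨permFiniteMetricGroup (Fin n × Bool) hder, permAmplify (Fin n) Bool,
    fun σ τ => ?_, fun σ => ?_⟩ <;> rw [one_mul]
  · exact (hammingMetric_permAmplify σ τ).le
  · exact ((hammingMetric_permAmplify σ 1).symm.trans
      (congrArg (hammingMetric _) (map_one (permAmplify (Fin n) Bool)))).le

theorem uniformlyEmbeds_finiteMetricGroup_prod :
    UniformlyEmbeds
      (fun k : FiniteMetricGroup × FiniteMetricGroup => k.1.carrier × k.2.carrier)
      (fun k => maxDist k.1.d k.2.d) FiniteMetricGroup.carrier FiniteMetricGroup.d :=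
  .of_linear_bounds one_pos one_pos fun k =>
    ⟨k.1.prod k.2, MonoidHom.id _, fun _ _ => (one_mul _).ge, fun _ => (one_mul _).ge⟩

end WeaklySofic

section AmplifiedSum

variable {m n o K : Type*} [Fintype m] [Fintype n]

/-- The direct sum of two square matrices, each repeated so that both summands have the same
size. -/
def matrixAmplifiedSum (m n R : Type*) [Fintype m] [Fintype n] [DecidableEq m] [DecidableEq n]
    [Ring R] :
    Matrix m m R × Matrix n n R →+* Matrix (m × n ⊕ n × m) (m × n ⊕ n × m) R where
  toFun M := Matrix.fromBlocks (Matrix.blockDiagonal fun _ : n => M.1) 0 0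
    (Matrix.blockDiagonal fun _ : m => M.2)
  map_one' := by
    rw [← Matrix.fromBlocks_one]
    congr 1 <;> exact Matrix.blockDiagonal_one
  map_mul' M N := by
    simp only [Matrix.fromBlocks_multiply, Prod.fst_mul, Prod.snd_mul, Matrix.blockDiagonal_mul,
      Matrix.mul_zero, Matrix.zero_mul, add_zero, zero_add]
  map_zero' := by
    rw [← Matrix.fromBlocks_zero]
    congr 1 <;> exact Matrix.blockDiagonal_zero
  map_add' M N := by
    rw [Matrix.fromBlocks_add, add_zero, add_zero, ← Matrix.blockDiagonal_add,
      ← Matrix.blockDiagonal_add]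
    rfl

theorem matrixAmplifiedSum_apply [DecidableEq m] [DecidableEq n] {R : Type*} [Ring R]
    (M : Matrix m m R × Matrix n n R) :
    matrixAmplifiedSum m n R M = Matrix.fromBlocks (Matrix.blockDiagonal fun _ : n => M.1) 0 0
      (Matrix.blockDiagonal fun _ : m => M.2) := rfl

theorem rank_mul_mul_of_isUnit [DecidableEq m] [Field K] {V U : Matrix m m K} (M : Matrix m m K)
    (hV : IsUnit V) (hU : IsUnit U) : (V * M * U).rank = M.rank := by
  rw [Matrix.rank_mul_eq_left_of_isUnit_det _ _ ((Matrix.isUnit_iff_isUnit_det _).1 hU),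
    Matrix.rank_mul_eq_right_of_isUnit_det _ _ ((Matrix.isUnit_iff_isUnit_det _).1 hV)]

theorem exists_isUnit_mul_mul_eq_diagonal [DecidableEq m] [Field K] (M : Matrix m m K) :
    ∃ (V U : Matrix m m K) (D : m → K), IsUnit V ∧ IsUnit U ∧ V * M * U = Matrix.diagonal D := by
  obtain ⟨V, U, e, hV, hU, h⟩ := Matrix.exists_rank_normal_form M
  refine ⟨V, U, Sum.elim (fun _ => 1) (fun _ => 0) ∘ e, hV, hU, ?_⟩
  rw [h, ← Matrix.submatrix_diagonal_equiv, ← Matrix.fromBlocks_diagonal, Matrix.diagonal_one,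
    Matrix.diagonal_zero]

theorem rank_diagonal_eq_sum_ite [DecidableEq m] [Field K] [DecidableEq K] (D : m → K) :
    (Matrix.diagonal D).rank = ∑ i, if D i ≠ 0 then 1 else 0 := by
  rw [Matrix.rank_diagonal, Fintype.card_subtype, Finset.card_filter]

theorem rank_blockDiagonal [Fintype o] [DecidableEq o] [Field K] (M : o → Matrix m m K) :
    (Matrix.blockDiagonal M).rank = ∑ i, (M i).rank := by
  classical
  choose V U D hV hU hD using fun i => exists_isUnit_mul_mul_eq_diagonal (M i)
  have hV' : IsUnit (Matrix.blockDiagonal V) :=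
    (Pi.isUnit_iff.2 hV).map (Matrix.blockDiagonalRingHom m o K)
  have hU' : IsUnit (Matrix.blockDiagonal U) :=
    (Pi.isUnit_iff.2 hU).map (Matrix.blockDiagonalRingHom m o K)
  rw [← rank_mul_mul_of_isUnit _ hV' hU', ← Matrix.blockDiagonal_mul, ← Matrix.blockDiagonal_mul,
    funext hD, Matrix.blockDiagonal_diagonal, rank_diagonal_eq_sum_ite,
    Fintype.sum_prod_type_right]
  refine Finset.sum_congr rfl fun i _ => ?_
  rw [← rank_mul_mul_of_isUnit (M i) (hV i) (hU i), hD, rank_diagonal_eq_sum_ite]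

theorem rank_fromBlocks_zero [Field K] (M : Matrix m m K) (N : Matrix n n K) :
    (Matrix.fromBlocks M 0 0 N).rank = M.rank + N.rank := by
  classical
  obtain ⟨V, U, D, hV, hU, hD⟩ := exists_isUnit_mul_mul_eq_diagonal M
  obtain ⟨V', U', D', hV', hU', hD'⟩ := exists_isUnit_mul_mul_eq_diagonal N
  have hsum : Matrix.fromBlocks V 0 0 V' * Matrix.fromBlocks M 0 0 N * Matrix.fromBlocks U 0 0 U'
      = Matrix.diagonal (Sum.elim D D') := by
    simp only [Matrix.fromBlocks_multiply, Matrix.mul_zero, Matrix.zero_mul, add_zero, zero_add,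
      hD, hD', Matrix.fromBlocks_diagonal]
  rw [← rank_mul_mul_of_isUnit _ (Matrix.isUnit_fromBlocks_zero₂₁.2 ⟨hV, hV'⟩)
      (Matrix.isUnit_fromBlocks_zero₂₁.2 ⟨hU, hU'⟩), hsum, rank_diagonal_eq_sum_ite,
    Fintype.sum_sum_type, ← rank_mul_mul_of_isUnit M hV hU, ← rank_mul_mul_of_isUnit N hV' hU',
    hD, hD', rank_diagonal_eq_sum_ite, rank_diagonal_eq_sum_ite]
  rfl

theorem rank_matrixAmplifiedSum [DecidableEq m] [DecidableEq n] [Field K]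
    (M : Matrix m m K × Matrix n n K) :
    (matrixAmplifiedSum m n K M).rank
      = Fintype.card n * M.1.rank + Fintype.card m * M.2.rank := by
  rw [matrixAmplifiedSum_apply, rank_fromBlocks_zero, rank_blockDiagonal, rank_blockDiagonal,
    Finset.sum_const, Finset.sum_const, Finset.card_univ, Finset.card_univ, smul_eq_mul,
    smul_eq_mul]

theorem star_matrixAmplifiedSum [DecidableEq m] [DecidableEq n] {R : Type*} [Ring R] [StarRing R]
    (M : Matrix m m R × Matrix n n R) :
    matrixAmplifiedSum m n R (star M) = star (matrixAmplifiedSum m n R M) := by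
  simp only [matrixAmplifiedSum_apply, Matrix.star_eq_conjTranspose,
    Matrix.fromBlocks_conjTranspose, Matrix.blockDiagonal_conjTranspose,
    Matrix.conjTranspose_zero, Prod.fst_star, Prod.snd_star]

theorem sum_norm_sq_matrixAmplifiedSum [DecidableEq m] [DecidableEq n] {R : Type*} [NormedRing R]
    (M : Matrix m m R × Matrix n n R) :
    ∑ i, ∑ j, ‖matrixAmplifiedSum m n R M i j‖ ^ 2
      = Fintype.card n * ∑ i, ∑ j, ‖M.1 i j‖ ^ 2 + Fintype.card m * ∑ i, ∑ j, ‖M.2 i j‖ ^ 2 := by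
  simp only [matrixAmplifiedSum_apply, Fintype.sum_sum_type, Matrix.fromBlocks_apply₁₁,
    Matrix.fromBlocks_apply₁₂, Matrix.fromBlocks_apply₂₁, Matrix.fromBlocks_apply₂₂,
    Matrix.zero_apply, norm_zero, Fintype.sum_prod_type, Matrix.blockDiagonal_apply,
    apply_ite norm, ite_pow, ne_eq, OfNat.ofNat_ne_zero, not_false_eq_true, zero_pow,
    Finset.sum_const_zero, add_zero, zero_add, Finset.sum_ite_eq, Finset.mem_univ, if_true,
    Finset.sum_const, Finset.card_univ, nsmul_eq_mul, Finset.mul_sum]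

end AmplifiedSum

section PermutationMatrices

theorem permMatrixHom_apply {A R : Type*} [Fintype A] [DecidableEq A] [NonAssocSemiring R]
    (σ : Equiv.Perm A) (i j : A) :
    (Matrix.permMatrixHom σ : Matrix A A R) i j = if i = σ j then 1 else 0 := by
  rw [Matrix.permMatrixHom_apply, Equiv.Perm.permMatrix, PEquiv.toMatrix_apply,
    Equiv.toPEquiv_apply]
  simp only [Option.mem_some_iff, Equiv.Perm.inv_eq_iff_eq]

theorem transpose_permMatrixHom {A R : Type*} [Fintype A] [DecidableEq A] [NonAssocSemiring R]
    (σ : Equiv.Perm A) :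
    (Matrix.permMatrixHom σ : Matrix A A R).transpose = Matrix.permMatrixHom σ⁻¹ :=
  Matrix.transpose_permMatrix _

variable {A K : Type*} [Fintype A] [Field K]

theorem rank_permMatrixHom_sub_le_hammingDist [DecidableEq A] (σ τ : Equiv.Perm A) :
    (Matrix.permMatrixHom σ - Matrix.permMatrixHom τ : Matrix A A K).rank ≤ hammingDist σ τ := by
  rw [← Matrix.rank_transpose]
  refine Matrix.rank_le_card_of_support_subset _ _ (Function.support_subset_iff.2 fun a ha => ?_)
  refine Finset.mem_coe.2 ((Finset.mem_filter_univ a).2 fun hστ => ha (funext fun i => ?_))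
  rw [Matrix.row_apply, Matrix.transpose_apply, Matrix.sub_apply, permMatrixHom_apply,
    permMatrixHom_apply, hστ, sub_self, Pi.zero_apply]

-- The rows and columns indexed by the ascents span a triangular minor with diagonal entries `-1`.
theorem card_filter_lt_le_rank_permMatrixHom_sub_one [LinearOrder A] (σ : Equiv.Perm A) :
    (Finset.univ.filter fun a => a < σ a).card
      ≤ (Matrix.permMatrixHom σ - 1 : Matrix A A K).rank := by
  let T : Finset A := Finset.univ.filter fun a => a < σ a
  have hT : ∀ a : T, (a : A) < σ a := fun a => (Finset.mem_filter_univ (a : A)).1 a.2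
  let M : Matrix T T K := (Matrix.permMatrixHom σ - 1 : Matrix A A K).submatrix (↑) (↑)
  have hM : ∀ i j, M i j = (if (i : A) = σ j then 1 else 0) - if i = j then 1 else 0 := by
    intro i j
    change (Matrix.permMatrixHom σ - 1 : Matrix A A K) i j = _
    rw [Matrix.sub_apply, permMatrixHom_apply, Matrix.one_apply]
    simp only [Subtype.ext_iff]
  have hlower : M.IsLowerTriangular := fun i j (hij : i < j) => by
    rw [hM, if_neg (Subtype.coe_lt_coe.2 hij |>.trans (hT j)).ne, if_neg hij.ne, sub_zero]
  have hdiag : ∀ i, M i i = -1 := fun i => by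
    rw [hM, if_neg (hT i).ne, if_pos rfl, zero_sub]
  have hdet : M.det ≠ 0 := by
    rw [Matrix.det_of_isLowerTriangular M hlower]
    exact Finset.prod_ne_zero_iff.2 fun i _ => (hdiag i).trans_ne (neg_ne_zero.2 one_ne_zero)
  calc T.card = M.rank := by rw [Matrix.rank_of_det_ne_zero hdet, Fintype.card_coe]
    _ ≤ (Matrix.permMatrixHom σ - 1 : Matrix A A K).rank := Matrix.rank_submatrix_le _ _ _

theorem card_filter_gt_le_rank_permMatrixHom_sub_one [LinearOrder A] (σ : Equiv.Perm A) :
    (Finset.univ.filter fun a => σ a < a).card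
      ≤ (Matrix.permMatrixHom σ - 1 : Matrix A A K).rank := by
  have hcard : (Finset.univ.filter fun a => σ a < a).card
      = (Finset.univ.filter fun a => a < σ⁻¹ a).card :=
    Finset.card_equiv σ fun a => by
      rw [Finset.mem_filter_univ, Finset.mem_filter_univ, Equiv.Perm.inv_def,
        Equiv.symm_apply_apply]
  rw [hcard, ← Matrix.rank_transpose, Matrix.transpose_sub, Matrix.transpose_one,
    transpose_permMatrixHom]
  exact card_filter_lt_le_rank_permMatrixHom_sub_one σ⁻¹

theorem hammingDist_one_le_two_mul_rank [LinearOrder A] (σ : Equiv.Perm A) :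
    hammingDist σ (1 : Equiv.Perm A)
      ≤ 2 * (Matrix.permMatrixHom σ - 1 : Matrix A A K).rank := by
  have hsplit : (Finset.univ.filter fun a => σ a ≠ (1 : Equiv.Perm A) a)
      ⊆ (Finset.univ.filter fun a => a < σ a) ∪ Finset.univ.filter fun a => σ a < a := by
    intro a ha
    rw [Finset.mem_union, Finset.mem_filter_univ, Finset.mem_filter_univ]
    exact ((Finset.mem_filter_univ a).1 ha).lt_or_gt.symm
  calc hammingDist σ (1 : Equiv.Perm A)
      ≤ (Finset.univ.filter fun a => a < σ a).card + (Finset.univ.filter fun a => σ a < a).card :=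
        (Finset.card_le_card hsplit).trans (Finset.card_union_le _ _)
    _ ≤ _ := by
        rw [two_mul]
        exact Nat.add_le_add (card_filter_lt_le_rank_permMatrixHom_sub_one σ)
          (card_filter_gt_le_rank_permMatrixHom_sub_one σ)

theorem sum_norm_sq_permMatrixHom_sub {R : Type*} [NormedRing R] [NormOneClass R] [DecidableEq A]
    (σ τ : Equiv.Perm A) :
    ∑ i, ∑ j, ‖(Matrix.permMatrixHom σ : Matrix A A R) i j - Matrix.permMatrixHom τ i j‖ ^ 2
      = 2 * (hammingDist σ τ : ℝ) := by
  simp only [permMatrixHom_apply]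
  rw [Finset.sum_comm, hammingDist, Finset.card_filter, Nat.cast_sum, Finset.mul_sum]
  refine Finset.sum_congr rfl fun j _ => ?_
  by_cases hj : σ j = τ j
  · simp only [hj, sub_self, norm_zero, ne_eq, not_true_eq_false, OfNat.ofNat_ne_zero,
      not_false_eq_true, zero_pow, Finset.sum_const_zero, if_false, Nat.cast_zero, mul_zero]
  · have hentry : ∀ i, ‖((if i = σ j then 1 else 0) - if i = τ j then 1 else 0 : R)‖ ^ 2
        = (if i = σ j then (1 : ℝ) else 0) + if i = τ j then 1 else 0 := fun i => by
      by_cases hσ : i = σ j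
      · simp only [hσ, hj, if_true, if_false, sub_zero, norm_one, one_pow, add_zero]
      · by_cases hτ : i = τ j <;>
          simp only [hσ, hτ, Ne.symm hj, if_true, if_false, zero_sub, sub_self, norm_neg, norm_one,
            norm_zero, one_pow, zero_add, ne_eq, OfNat.ofNat_ne_zero, not_false_eq_true, zero_pow]
    simp only [hentry, Finset.sum_add_distrib, Finset.sum_ite_eq', Finset.mem_univ, if_true, hj,
      ne_eq, not_false_eq_true, Nat.cast_one]
    norm_num

end PermutationMatrices

section LinearSofic

theorem exists_generalLinearGroup_fin_hom (A K : Type*) [Fintype A] [DecidableEq A] [Nonempty A]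
    [Field K] :
    ∃ (n : ℕ+) (ρ : Matrix.GeneralLinearGroup A K →* Matrix.GeneralLinearGroup (Fin n) K),
      ∀ M N, rankMetric (ρ M) (ρ N) = ((M - N : Matrix A A K).rank : ℝ) / Fintype.card A := by
  let n : ℕ+ := ⟨Fintype.card A, Fintype.card_pos⟩
  let e : A ≃ Fin n := Fintype.equivFin A
  refine ⟨n, Units.map (Matrix.reindexAlgEquiv K K e : Matrix A A K →* Matrix (Fin n) (Fin n) K),
    fun M N => ?_⟩
  rw [← Matrix.rank_reindex e e (M - N : Matrix A A K)]
  rfl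

theorem rankMetric_nonneg {K : Type*} [Field K] {n : ℕ}
    (M N : Matrix.GeneralLinearGroup (Fin n) K) : 0 ≤ rankMetric M N := by
  unfold rankMetric
  positivity

variable (K : Type*) [Field K]

theorem uniformlyEmbeds_perm_generalLinearGroup :
    UniformlyEmbeds (fun n : ℕ+ => Equiv.Perm (Fin n)) (fun _ => hammingMetric)
      (fun n : ℕ+ => Matrix.GeneralLinearGroup (Fin n) K) (fun _ => rankMetric) := by
  refine .of_linear_bounds one_pos two_pos fun n => ⟨n, Matrix.permMatrixHom.toHomUnits,
    fun σ τ => ?_, fun σ => ?_⟩ <;>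
    rw [hammingMetric_eq_hammingDist_div, rankMetric, Fintype.card_fin]
  · rw [one_mul]
    gcongr
    exact rank_permMatrixHom_sub_le_hammingDist σ τ
  · rw [← mul_div_assoc]
    gcongr
    exact_mod_cast hammingDist_one_le_two_mul_rank σ

theorem uniformlyEmbeds_generalLinearGroup_prod :
    UniformlyEmbeds (fun k : ℕ+ × ℕ+ =>
        Matrix.GeneralLinearGroup (Fin k.1) K × Matrix.GeneralLinearGroup (Fin k.2) K)
      (fun _ => maxDist rankMetric rankMetric)
      (fun n : ℕ+ => Matrix.GeneralLinearGroup (Fin n) K) (fun _ => rankMetric) := by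
  refine .maxDist_of_average (fun n : ℕ+ => rankMetric_nonneg (K := K) (n := n)) fun m n => ?_
  obtain ⟨k, ρ, hρ⟩ := exists_generalLinearGroup_fin_hom (Fin m × Fin n ⊕ Fin n × Fin m) K
  let f := (Units.map (matrixAmplifiedSum (Fin m) (Fin n) K).toMonoidHom).comp
    MulEquiv.prodUnits.symm.toMonoidHom
  refine ⟨k, ρ.comp f, fun p q => ?_⟩
  have hrank : (f p - f q :
        Matrix (Fin m × Fin n ⊕ Fin n × Fin m) (Fin m × Fin n ⊕ Fin n × Fin m) K).rank
      = n * (p.1.val - q.1.val).rank + m * (p.2.val - q.2.val).rank := by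
    have h := rank_matrixAmplifiedSum ((p.1.val, p.2.val) - (q.1.val, q.2.val))
    rw [map_sub, Fintype.card_fin, Fintype.card_fin] at h
    exact h
  refine (hρ (f p) (f q)).trans ?_
  rw [hrank]
  simp only [rankMetric, Fintype.card_sum, Fintype.card_prod, Fintype.card_fin]
  push_cast
  field_simp
  ring

end LinearSofic

section Hyperlinear

theorem exists_unitaryGroup_fin_hom {A H : Type*} [Fintype A] [DecidableEq A] [Nonempty A]
    [Group H] (f : H →* Matrix A A ℂ) (hf : ∀ x, f x ∈ Matrix.unitaryGroup A ℂ) :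
    ∃ (n : ℕ+) (ρ : H →* Matrix.unitaryGroup (Fin n) ℂ), ∀ x y,
      hilbertSchmidtMetric (ρ x) (ρ y)
        = Real.sqrt ((∑ i, ∑ j, ‖f x i j - f y i j‖ ^ 2) / Fintype.card A) := by
  let n : ℕ+ := ⟨Fintype.card A, Fintype.card_pos⟩
  let e : A ≃ Fin n := Fintype.equivFin A
  let r : Matrix A A ℂ →⋆* Matrix (Fin n) (Fin n) ℂ :=
    { (Matrix.reindexAlgEquiv ℂ ℂ e : Matrix A A ℂ →* Matrix (Fin n) (Fin n) ℂ) with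
      map_star' := fun _ => rfl }
  have hr : ∀ M i j, r M (e i) (e j) = M i j := fun M i j =>
    congrArg₂ M (e.symm_apply_apply i) (e.symm_apply_apply j)
  refine ⟨n, (Unitary.map r).toMonoidHom.comp (f.codRestrict _ hf), fun x y => ?_⟩
  have hsum : ∑ i, ∑ j, ‖f x i j - f y i j‖ ^ 2 = ∑ i, ∑ j, ‖r (f x) i j - r (f y) i j‖ ^ 2 :=
    Fintype.sum_equiv e _ _ fun i => Fintype.sum_equiv e _ _ fun j => by rw [hr, hr]
  rw [hilbertSchmidtMetric, one_div_mul_eq_div, hsum]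
  rfl

theorem permMatrixHom_mem_unitaryGroup {A R : Type*} [Fintype A] [DecidableEq A] [CommRing R]
    [StarRing R] (σ : Equiv.Perm A) :
    (Matrix.permMatrixHom σ : Matrix A A R) ∈ Matrix.unitaryGroup A R := by
  have hstar : star (Matrix.permMatrixHom σ : Matrix A A R) = Matrix.permMatrixHom σ⁻¹ :=
    Matrix.conjTranspose_permMatrix _
  rw [Matrix.mem_unitaryGroup_iff, hstar, ← map_mul, mul_inv_cancel, map_one]

theorem matrixAmplifiedSum_mem_unitaryGroup {m n R : Type*} [Fintype m] [Fintype n]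
    [DecidableEq m] [DecidableEq n] [CommRing R] [StarRing R]
    (p : Matrix.unitaryGroup m R × Matrix.unitaryGroup n R) :
    matrixAmplifiedSum m n R (p.1, p.2) ∈ Matrix.unitaryGroup (m × n ⊕ n × m) R := by
  have hp : ((p.1.val, p.2.val) : Matrix m m R × Matrix n n R) * star (p.1.val, p.2.val) = 1 :=
    Prod.ext (Matrix.mem_unitaryGroup_iff.1 p.1.2) (Matrix.mem_unitaryGroup_iff.1 p.2.2)
  rw [Matrix.mem_unitaryGroup_iff, ← star_matrixAmplifiedSum, ← map_mul, hp, map_one]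

theorem exists_perm_unitaryGroup_hom (n : ℕ+) :
    ∃ (k : ℕ+) (ρ : Equiv.Perm (Fin n) →* Matrix.unitaryGroup (Fin k) ℂ), ∀ σ τ,
      hilbertSchmidtMetric (ρ σ) (ρ τ) = Real.sqrt (2 * hammingMetric σ τ) := by
  obtain ⟨k, ρ, hρ⟩ := exists_unitaryGroup_fin_hom (Matrix.permMatrixHom (n := Fin n))
    permMatrixHom_mem_unitaryGroup
  refine ⟨k, ρ, fun σ τ => ?_⟩
  rw [hρ, sum_norm_sq_permMatrixHom_sub, hammingMetric_eq_hammingDist_div, mul_div_assoc]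

theorem uniformlyEmbeds_perm_unitaryGroup :
    UniformlyEmbeds (fun n : ℕ+ => Equiv.Perm (Fin n)) (fun _ => hammingMetric)
      (fun n : ℕ+ => Matrix.unitaryGroup (Fin n) ℂ) (fun _ => hilbertSchmidtMetric) := by
  choose k ρ hρ using exists_perm_unitaryGroup_hom
  refine ⟨k, ρ, fun ε hε => ⟨ε ^ 2 / 2, by positivity, fun n σ τ hστ => ?_⟩,
    fun c hc => ⟨Real.sqrt (2 * c), by positivity, fun n σ hσ => ?_⟩⟩
  · refine (hρ n σ τ).trans_lt ((Real.sqrt_lt' hε).2 ?_)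
    linarith
  · rw [← map_one (ρ n)]
    exact (Real.sqrt_lt_sqrt (by positivity) (by linarith)).trans_eq (hρ n σ 1).symm

theorem exists_unitaryGroup_prod_hom (m n : ℕ+) :
    ∃ (k : ℕ+) (ρ : Matrix.unitaryGroup (Fin m) ℂ × Matrix.unitaryGroup (Fin n) ℂ →*
        Matrix.unitaryGroup (Fin k) ℂ), ∀ p q,
      hilbertSchmidtMetric (ρ p) (ρ q)
        = Real.sqrt
            ((hilbertSchmidtMetric p.1 q.1 ^ 2 + hilbertSchmidtMetric p.2 q.2 ^ 2) / 2) := by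
  let f : Matrix.unitaryGroup (Fin m) ℂ × Matrix.unitaryGroup (Fin n) ℂ →*
      Matrix (Fin m × Fin n ⊕ Fin n × Fin m) (Fin m × Fin n ⊕ Fin n × Fin m) ℂ :=
    (matrixAmplifiedSum (Fin m) (Fin n) ℂ).toMonoidHom.comp
      ((Matrix.unitaryGroup (Fin m) ℂ).subtype.prodMap (Matrix.unitaryGroup (Fin n) ℂ).subtype)
  obtain ⟨k, ρ, hρ⟩ := exists_unitaryGroup_fin_hom f matrixAmplifiedSum_mem_unitaryGroup
  refine ⟨k, ρ, fun p q => ?_⟩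
  have hsum : ∑ i, ∑ j, ‖f p i j - f q i j‖ ^ 2
      = n * ∑ i, ∑ j, ‖p.1.val i j - q.1.val i j‖ ^ 2
        + m * ∑ i, ∑ j, ‖p.2.val i j - q.2.val i j‖ ^ 2 := by
    have h := sum_norm_sq_matrixAmplifiedSum (R := ℂ)
      ((p.1.val, p.2.val) - (q.1.val, q.2.val))
    rw [map_sub, Fintype.card_fin, Fintype.card_fin] at h
    exact h
  rw [hρ, hsum, hilbertSchmidtMetric, hilbertSchmidtMetric, Real.sq_sqrt (by positivity),
    Real.sq_sqrt (by positivity)]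
  congr 1
  simp only [Fintype.card_sum, Fintype.card_prod, Fintype.card_fin]
  push_cast
  field_simp
  ring

theorem uniformlyEmbeds_unitaryGroup_prod :
    UniformlyEmbeds (fun k : ℕ+ × ℕ+ =>
        Matrix.unitaryGroup (Fin k.1) ℂ × Matrix.unitaryGroup (Fin k.2) ℂ)
      (fun _ => maxDist hilbertSchmidtMetric hilbertSchmidtMetric)
      (fun n : ℕ+ => Matrix.unitaryGroup (Fin n) ℂ) (fun _ => hilbertSchmidtMetric) := by
  refine .of_linear_bounds one_pos two_pos fun k => ?_
  obtain ⟨l, ρ, hρ⟩ := exists_unitaryGroup_prod_hom k.1 k.2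
  have hnonneg : ∀ (n : ℕ+) (M N : Matrix.unitaryGroup (Fin n) ℂ),
    0 ≤ hilbertSchmidtMetric M N := fun _ _ _ => Real.sqrt_nonneg _
  refine ⟨l, ρ, fun p q => ?_, fun p => max_le ?_ ?_⟩
  · rw [hρ, one_mul]
    refine Real.sqrt_le_iff.2 ⟨le_max_of_le_left (hnonneg _ _ _), ?_⟩
    have h₁ : hilbertSchmidtMetric p.1 q.1 ^ 2
        ≤ maxDist hilbertSchmidtMetric hilbertSchmidtMetric p q ^ 2 :=
      pow_le_pow_left₀ (hnonneg _ _ _) (le_max_left _ _) 2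
    have h₂ : hilbertSchmidtMetric p.2 q.2 ^ 2
        ≤ maxDist hilbertSchmidtMetric hilbertSchmidtMetric p q ^ 2 :=
      pow_le_pow_left₀ (hnonneg _ _ _) (le_max_right _ _) 2
    linarith
  all_goals
    rw [← div_le_iff₀' two_pos, ← map_one ρ, hρ]
    refine Real.le_sqrt_of_sq_le ?_
    nlinarith [sq_nonneg (hilbertSchmidtMetric p.1 1), sq_nonneg (hilbertSchmidtMetric p.2 1)]

end Hyperlinear

theorem mainTheorem10 {Γ : Type u} [Group Γ] {X : Type v} [MulAction Γ X]
    (hα : IsSoficAction Γ X) :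
    (IsSoficGroup Γ →
      IsSoficGroup (SymEnrichment Γ X) ∧ IsSoficGroup (AltEnrichment Γ X)) ∧
    (∀ (K : Type w) [Field K], IsLinearSoficGroup K Γ →
      IsLinearSoficGroup K (SymEnrichment Γ X) ∧ IsLinearSoficGroup K (AltEnrichment Γ X)) ∧
    (IsHyperlinearGroup Γ →
      IsHyperlinearGroup (SymEnrichment Γ X) ∧ IsHyperlinearGroup (AltEnrichment Γ X)) ∧
    (IsWeaklySoficGroup Γ →
      IsWeaklySoficGroup (SymEnrichment Γ X) ∧ IsWeaklySoficGroup (AltEnrichment Γ X)) := by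
  refine ⟨fun hΓ => ?_, fun K _ hΓ => ?_, fun hΓ => ?_, fun hΓ => ?_⟩
  · have h {N : Subgroup (Equiv.Perm X)} [N.Normal] := hΓ.semidirectProduct (N := N)
      (.refl _ _) uniformlyEmbeds_perm_prod_perm hα
    exact ⟨h le_rfl, h (finAlt_le_finSym X)⟩
  · have h {N : Subgroup (Equiv.Perm X)} [N.Normal] := hΓ.semidirectProduct (N := N)
      (uniformlyEmbeds_perm_generalLinearGroup K) (uniformlyEmbeds_generalLinearGroup_prod K) hα
    exact ⟨h le_rfl, h (finAlt_le_finSym X)⟩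
  · have h {N : Subgroup (Equiv.Perm X)} [N.Normal] := hΓ.semidirectProduct (N := N)
      uniformlyEmbeds_perm_unitaryGroup uniformlyEmbeds_unitaryGroup_prod hα
    exact ⟨h le_rfl, h (finAlt_le_finSym X)⟩
  · have h {N : Subgroup (Equiv.Perm X)} [N.Normal] := hΓ.semidirectProduct (N := N)
      uniformlyEmbeds_perm_finiteMetricGroup uniformlyEmbeds_finiteMetricGroup_prod hα
    exact ⟨h le_rfl, h (finAlt_le_finSym X)⟩
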